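/- A submodular MDP consists of a finite state space $\mathcal S$, a finite nonempty action space $\mathcal A$, a horizon $H\ge 1$, a transition operator $P:\mathcal S\times\mathcal A\to\Delta(\mathcal S)$, disjoint levels $\mathcal S_1,\dots,\mathcal S_H\subseteq\mathcal S$ with a fixed initial state $s_1\in\mathcal S_1$, such that $P(s,a)$ is supported on $\mathcal S_{h+1}$ for $s\in\mathcal S_h$, $h<H$, and a monotone submodular function $f:2^{\mathcal S\times\mathcal A}\to\mathbb R_{\ge 0}$. A policy $\pi:\mathcal S^*\to\Delta(\mathcal A)$ induces a random trajectory by $a_h\sim\pi(s_1,\dots,s_h)$, $s_{h+1}\sim P(s_h,a_h)$; write $f(\pi)=\mathbb E\,f(\{(s_1,a_1),\dots,(s_H,a_H)\})$, and $x(\pi)_e$ for the probability that $e\in\mathcal S\times\mathcal A$ lies on the trajectory. For a policy that is itself drawn at random (once, before the episode), $f$ is also averaged over that draw. For $y\in[0,1]^{\mathcal S\times\mathcal A}$ let $S^y\subseteq\mathcal S\times\mathcal A$ be the random set that contains each $e$ independently with probability $y_e$. The discretized continuous greedy algorithm sets $\delta=\frac1{9|\mathcal S|^2|\mathcal A|^2}$,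 $T=1/\delta$, $R=\lceil 10(1+\log(|\mathcal S||\mathcal A|))/\delta^2\rceil$ and $y_0=0$. For $t=1,\dots,T$ it computes, for each $e\in\mathcal S\times\mathcal A$, the average $w_t(e)$ of $f(X\cup\{e\})-f(X\setminus\{e\})$ over $R$ fresh independent samples $X$ of $S^{y_{t-1}}$; it finds by dynamic programming (backward induction for the MDP with additive reward $w_t$, ties broken arbitrarily) a deterministic policy $\pi_t$ maximizing $x(\pi_t)\cdot w_t$; and it sets $y_t=y_{t-1}+\delta\,x(\pi_t)$. Its output is the random policy $\pi$ that is uniformly distributed over $\pi_1,\dots,\pi_T$. Theorem. There is a function $\varepsilon:\mathbb N\to[0,1-1/e]$ with $\varepsilon(n)\to0$ as $n\to\infty$ such that, for every submodular MDP and every tie-breaking rule, with probability at least $0.99$ over the samples of the algorithm, $$f(\pi)\ \ge\ \frac{\bigl(1-1/e-\varepsilon(|\mathcal S||\mathcal A|)\bigr)^2}{H}\, f(\pi^*)\qquad\text{for every policy }\pi^*,$$ in particular for an optimal policy $\pi^*$. -/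

import Mathlib

open scoped ENNReal

/-- A finite-horizon tabular Markov decision process with a monotone submodular objective.
Levels are numbered `0, …, H - 1`; the states at level `h` are `{s | level s = h}`, so that
different levels are disjoint.  States with `level s ≥ H` belong to no level of the process. -/
structure SubmodularMDP (S A : Type*) [DecidableEq S] [DecidableEq A] where
  /-- the planning horizon -/
  H : ℕ
  H_pos : 0 < H
  /-- the transition operator -/
  P : S → A → PMF S
  /-- the fixed initial state -/
  s₁ : S
  level : S → ℕ
  level_init : level s₁ = 0
  level_step : ∀ s a s', level s + 1 < H → s' ∈ (P s a).support → level s' = level s + 1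
  /-- the objective function -/
  f : Finset (S × A) → ℝ
  f_nonneg : ∀ X, 0 ≤ f X
  f_mono : ∀ X Y, X ⊆ Y → f X ≤ f Y
  f_submodular : ∀ X Y, f (X ∪ Y) + f (X ∩ Y) ≤ f X + f Y

/-- A policy prescribes a distribution over actions for each sequence of states
`[s₁, …, s_h]` (the states visited so far, in chronological order, ending in the current one). -/
abbrev Policy (S A : Type*) := List S → PMF A

noncomputable section

/-- The product distribution: independent coordinates, the `i`-th one with law `p i`. -/
def indepPMF {ι α : Type*} [Fintype ι] [DecidableEq ι] [Fintype α] (p : ι → PMF α) :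
    PMF (ι → α) :=
  PMF.ofFintype (fun g => ∏ i, p i (g i)) (by
    have h : ∀ i, ∑ a, p i a = 1 := fun i => by
      rw [← tsum_fintype (L := .unconditional _)]
      exact (p i).tsum_coe
    rw [← Fintype.prod_sum]
    simp [h])

/-- A coin that shows `true` with probability `x` (for real `x` in `[0, 1]`; other values are
replaced by the nearest point of `[0, 1]`). -/
def coin (x : ℝ) : PMF Bool :=
  PMF.ofFintype (fun b => bif b then min 1 (ENNReal.ofReal x) else 1 - min 1 (ENNReal.ofReal x))
    (by simp)

/-- The law of the random subset `S^x`, which contains each `e` independently with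
probability `x e`. -/
def randomSubset {E : Type*} [Fintype E] [DecidableEq E] (x : E → ℝ) : PMF (Finset E) :=
  (indepPMF fun e => coin (x e)).map fun b => Finset.univ.filter fun e => b e = true

namespace SubmodularMDP

variable {S A : Type*} [DecidableEq S] [DecidableEq A]

/-- The law of the next `k` state-action pairs under the policy `π`, when the current state is
`s` and the earlier states were `hist`. -/
def rollout (M : SubmodularMDP S A) (π : Policy S A) : ℕ → List S → S → PMF (List (S × A))
  | 0, _, _ => PMF.pure []
  | k + 1, hist, s =>
      (π (hist ++ [s])).bind fun a =>
        (M.P s a).bind fun s' =>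
          (M.rollout π k (hist ++ [s]) s').map fun tr => (s, a) :: tr

/-- The law of the trajectory `(s₁, a₁), …, (s_H, a_H)` induced by `π`. -/
def trajectory (M : SubmodularMDP S A) (π : Policy S A) : PMF (List (S × A)) :=
  M.rollout π M.H [] M.s₁

/-- The law of the set of state-action pairs on the trajectory induced by `π`. -/
def visited (M : SubmodularMDP S A) (π : Policy S A) : PMF (Finset (S × A)) :=
  (M.trajectory π).map List.toFinset

variable [Fintype S] [Fintype A]

/-- The expectation `𝔼 f(X)` for a random set `X` with law `μ`. -/
def expect (M : SubmodularMDP S A) (μ : PMF (Finset (S × A))) : ℝ :=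
  ∑ X, (μ X).toReal * M.f X

/-- The expected objective value `f(π)` of a policy. -/
def value (M : SubmodularMDP S A) (π : Policy S A) : ℝ :=
  M.expect (M.visited π)

/-- The expected objective value of a random policy: first a policy is drawn from `ρ`, then it is
followed for the whole episode. -/
def randomValue (M : SubmodularMDP S A) (ρ : PMF (Policy S A)) : ℝ :=
  M.expect (ρ.bind M.visited)

/-- The marginal probability `x(π)_e` that `e` lies on the trajectory induced by `π`. -/
def marginal (M : SubmodularMDP S A) (π : Policy S A) (e : S × A) : ℝ :=
  ∑ X with e ∈ X, (M.visited π X).toReal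

/-- A deterministic Markov policy `d : S → A`, viewed as a policy: it plays `d s` in the current
state `s`, i.e. the last one of the sequence. -/
def ofDet (M : SubmodularMDP S A) (d : S → A) : Policy S A :=
  fun hist => PMF.pure (d (hist.getLastD M.s₁))

section DynamicProgramming

variable [Nonempty A]

/-- The optimal value-to-go from state `s` with `k` steps left, for the additive reward `w`. -/
def dpValue (M : SubmodularMDP S A) (w : S × A → ℝ) : ℕ → S → ℝ
  | 0, _ => 0
  | k + 1, s => Finset.univ.sup' Finset.univ_nonempty fun a =>
      w (s, a) + ∑ s', (M.P s a s').toReal * M.dpValue w k s'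

/-- The optimal state-action value when `k` further steps follow the present one. -/
def dpQ (M : SubmodularMDP S A) (w : S × A → ℝ) (k : ℕ) (s : S) (a : A) : ℝ :=
  w (s, a) + ∑ s', (M.P s a s').toReal * M.dpValue w k s'

/-- The deterministic policy that dynamic programming returns for the additive reward `w`; among
the maximizing actions at `s` it takes the one that the tie-breaking rule `arg s` selects. -/
def dpPolicy (M : SubmodularMDP S A) (arg : S → (A → ℝ) → A) (w : S × A → ℝ) : S → A :=
  fun s => arg s (M.dpQ w (M.H - 1 - M.level s) s)

end DynamicProgramming

end SubmodularMDP

/-- `arg t s q` is a maximizer of `q`, for each iteration `t` and each state `s`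
(ties may be broken in any way). -/
def IsArgmaxRule {S A : Type*} (arg : ℕ → S → (A → ℝ) → A) : Prop :=
  ∀ (t : ℕ) (s : S) (q : A → ℝ) (a : A), q a ≤ q (arg t s q)

section Parameters

variable (S A : Type*) [Fintype S] [Fintype A]

/-- The step size `δ = 1 / (9 |S|² |A|²)`. -/
def stepSize : ℝ := 1 / (9 * (Fintype.card S : ℝ) ^ 2 * (Fintype.card A : ℝ) ^ 2)

/-- The number of iterations `T = 1 / δ`. -/
def numSteps : ℕ := 9 * Fintype.card S ^ 2 * Fintype.card A ^ 2

/-- The number of samples per estimate, `R = 10 (1 + log (|S| |A|)) / δ²`, rounded up. -/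
def numSamples : ℕ :=
  ⌈10 * (1 + Real.log ((Fintype.card S : ℝ) * (Fintype.card A : ℝ))) / stepSize S A ^ 2⌉₊

end Parameters

namespace SubmodularMDP

variable {S A : Type*} [DecidableEq S] [DecidableEq A] [Fintype S] [Fintype A]

/-- The law of the vector `w` of estimates at `y`: for each `e`, the average of
`f(X ∪ {e}) - f(X \ {e})` over `R` independent samples `X` of the random set `S^y`. -/
def gradientEstimate (M : SubmodularMDP S A) (y : S × A → ℝ) : PMF (S × A → ℝ) :=
  (indepPMF fun _ : (S × A) × Fin (numSamples S A) => randomSubset y).map fun X e =>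
    (∑ r, (M.f (insert e (X (e, r))) - M.f ((X (e, r)).erase e))) / (numSamples S A : ℝ)

/-- The point `y_k = δ (x(π₁) + ⋯ + x(π_k))` reached after `k` iterations. -/
def position (M : SubmodularMDP S A) {k : ℕ} (d : Fin k → S → A) (e : S × A) : ℝ :=
  ∑ i, stepSize S A * M.marginal (M.ofDet (d i)) e

variable [Nonempty A]

/-- The law of the policies `π₁, …, π_k` found in the first `k` iterations. -/
def iterates (M : SubmodularMDP S A) (arg : ℕ → S → (A → ℝ) → A) :
    (k : ℕ) → PMF (Fin k → S → A)
  | 0 => PMF.pure Fin.elim0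
  | k + 1 => (M.iterates arg k).bind fun d =>
      (M.gradientEstimate (M.position d)).map fun w =>
        Fin.snoc (α := fun _ => S → A) d (M.dpPolicy (arg k) w)

/-- The random policy that is uniformly distributed over `π₁, …, π_T`. -/
def mixture (M : SubmodularMDP S A) (d : Fin (numSteps S A) → S → A) : PMF (Policy S A) :=
  haveI : Nonempty S := ⟨M.s₁⟩
  haveI : Nonempty (Fin (numSteps S A)) :=
    ⟨⟨0, Nat.mul_pos (Nat.mul_pos (by norm_num) (pow_pos Fintype.card_pos 2))
      (pow_pos Fintype.card_pos 2)⟩⟩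
  (PMF.uniformOfFintype (Fin (numSteps S A))).map fun t => M.ofDet (d t)

/-- The discretized continuous greedy algorithm: the law of its output, a random policy. -/
def continuousGreedy (M : SubmodularMDP S A) (arg : ℕ → S → (A → ℝ) → A) :
    PMF (PMF (Policy S A)) :=
  (M.iterates arg (numSteps S A)).map M.mixture

end SubmodularMDP

end

/-!
Let `F` be the multilinear extension of `f`, and `opt` the supremum of the values of all policies.
Submodularity gives `opt ≤ F(y) + max_π x(π) · ∇F(y)`, so a step of length `δ` along a maximizer
contracts `opt - F` by the factor `1 - δ`, and `T = 1/δ` steps leave at most `opt / e`.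

A step falls short of this in two ways. First, the gradient decreases along it; since the gradient
is antitone, these losses telescope once the coordinate `e` is weighted by the largest probability
`m e` with which any policy visits `e`. They add up to at most `δ |S| |A| opt`, because
`m e * (f {e} - f ∅) ≤ opt`. Second, the gradient is only estimated; with the same weights, the
variance of an average of `R ≥ 1/δ²` samples bounds the expected loss by `δ |S| |A| opt`, and
Markov's inequality applied to the accumulated loss suffices, without a union bound over the steps.

Finally `F(y_T) ≤ f ∅ + ∑ e, y_T e * (f {e} - f ∅) ≤ H f(π)`, as a trajectory has at most `H`
pairs. Rounding thus costs only the factor `1/H`, and the constant `1 - 1/e` enters unsquared.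
-/
/-! ### Expectations under distributions on finite types -/

section Mean

variable {α β : Type*} [Fintype α] [Fintype β]

/-- The expectation of a real function under a distribution on a finite type; the objective values
`SubmodularMDP.expect` are an instance of it. -/
noncomputable def mean (p : PMF α) (g : α → ℝ) : ℝ := ∑ a, (p a).toReal * g a

theorem sum_toReal_pmf (p : PMF α) : ∑ a, (p a).toReal = 1 := by
  rw [← ENNReal.toReal_sum fun a _ => p.apply_ne_top a,
    ← tsum_fintype (L := .unconditional _), p.tsum_coe, ENNReal.toReal_one]

theorem mean_const (p : PMF α) (c : ℝ) : mean p (fun _ => c) = c := by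
  rw [mean, ← Finset.sum_mul, sum_toReal_pmf, one_mul]

theorem mean_add (p : PMF α) (g h : α → ℝ) :
    mean p (fun a => g a + h a) = mean p g + mean p h := by
  simp only [mean, mul_add, Finset.sum_add_distrib]

theorem mean_const_add (p : PMF α) (c : ℝ) (g : α → ℝ) :
    mean p (fun a => c + g a) = c + mean p g := by
  rw [mean_add, mean_const]

theorem mean_const_mul (p : PMF α) (c : ℝ) (g : α → ℝ) :
    mean p (fun a => c * g a) = c * mean p g := by
  simp only [mean, Finset.mul_sum, mul_left_comm]

theorem mean_mul_const (p : PMF α) (g : α → ℝ) (c : ℝ) :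
    mean p (fun a => g a * c) = mean p g * c := by
  simp only [mul_comm _ c, mean_const_mul]

theorem mean_neg (p : PMF α) (g : α → ℝ) : mean p (fun a => -g a) = -mean p g := by
  simp only [mean, mul_neg, Finset.sum_neg_distrib]

theorem mean_sub (p : PMF α) (g h : α → ℝ) :
    mean p (fun a => g a - h a) = mean p g - mean p h := by
  simp only [sub_eq_add_neg, mean_add, mean_neg]

theorem mean_sum {ι : Type*} (s : Finset ι) (p : PMF α) (g : ι → α → ℝ) :
    mean p (fun a => ∑ i ∈ s, g i a) = ∑ i ∈ s, mean p (g i) := by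
  simp only [mean, Finset.mul_sum]
  exact Finset.sum_comm

theorem mean_le_mean_of_support {p : PMF α} {g h : α → ℝ} (hgh : ∀ a ∈ p.support, g a ≤ h a) :
    mean p g ≤ mean p h := by
  refine Finset.sum_le_sum fun a _ => ?_
  by_cases ha : a ∈ p.support
  · exact mul_le_mul_of_nonneg_left (hgh a ha) ENNReal.toReal_nonneg
  · simp [(p.apply_eq_zero_iff a).2 ha]

theorem mean_congr_of_support {p : PMF α} {g h : α → ℝ} (hgh : ∀ a ∈ p.support, g a = h a) :
    mean p g = mean p h :=
  le_antisymm (mean_le_mean_of_support fun a ha => (hgh a ha).le)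
    (mean_le_mean_of_support fun a ha => (hgh a ha).ge)

theorem mean_mono {p : PMF α} {g h : α → ℝ} (hgh : ∀ a, g a ≤ h a) : mean p g ≤ mean p h :=
  mean_le_mean_of_support fun a _ => hgh a

theorem mean_le_const {p : PMF α} {g : α → ℝ} {c : ℝ} (hg : ∀ a, g a ≤ c) : mean p g ≤ c :=
  (mean_mono hg).trans_eq (mean_const p c)

theorem const_le_mean {p : PMF α} {g : α → ℝ} {c : ℝ} (hg : ∀ a, c ≤ g a) : c ≤ mean p g :=
  (mean_const p c).symm.trans_le (mean_mono hg)

theorem mean_bind (p : PMF α) (q : α → PMF β) (g : β → ℝ) :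
    mean (p.bind q) g = mean p fun a => mean (q a) g := by
  have toReal_bind (b : β) : ((p.bind q) b).toReal = ∑ a, (p a).toReal * (q a b).toReal := by
    rw [PMF.bind_apply, tsum_fintype,
      ENNReal.toReal_sum fun a _ => ENNReal.mul_ne_top (p.apply_ne_top a) ((q a).apply_ne_top b)]
    simp only [ENNReal.toReal_mul]
  simp only [mean, toReal_bind, Finset.sum_mul, Finset.mul_sum, mul_assoc]
  exact Finset.sum_comm

theorem mean_pure (a : α) (g : α → ℝ) : mean (PMF.pure a) g = g a := by
  classical
  simp [mean, PMF.pure_apply, apply_ite ENNReal.toReal]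

theorem mean_map (p : PMF α) (u : α → β) (g : β → ℝ) :
    mean (p.map u) g = mean p fun a => g (u a) := by
  simp only [← PMF.bind_pure_comp, mean_bind, Function.comp_apply, mean_pure]

theorem sq_mean_le (p : PMF α) (g : α → ℝ) : mean p g ^ 2 ≤ mean p fun a => g a ^ 2 :=
  Real.pow_arith_mean_le_arith_mean_pow_of_even _ _ _ (fun _ _ => ENNReal.toReal_nonneg)
    (sum_toReal_pmf p) even_two

theorem toOuterMeasure_eq_ofReal_mean_indicator (p : PMF α) (s : Set α) :
    p.toOuterMeasure s = ENNReal.ofReal (mean p (s.indicator 1)) := by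
  classical
  rw [PMF.toOuterMeasure_apply_fintype, mean, ENNReal.ofReal_sum_of_nonneg
    fun a _ => mul_nonneg ENNReal.toReal_nonneg (Set.indicator_nonneg (by simp) a)]
  refine Finset.sum_congr rfl fun a _ => ?_
  by_cases ha : a ∈ s <;> simp [ha, ENNReal.ofReal_toReal (p.apply_ne_top a)]

theorem apply_eq_zero_of_mean_nonpos {p : PMF α} {g : α → ℝ} (hg : ∀ a, 0 ≤ g a)
    (hmean : mean p g ≤ 0) {a : α} (ha : a ∈ p.support) : g a = 0 := by
  have term_nonneg : ∀ b ∈ Finset.univ, 0 ≤ (p b).toReal * g b := fun b _ =>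
    mul_nonneg ENNReal.toReal_nonneg (hg b)
  have term_eq_zero := (Finset.sum_eq_zero_iff_of_nonneg term_nonneg).1
    (hmean.antisymm (Finset.sum_nonneg term_nonneg)) a (Finset.mem_univ a)
  exact (mul_eq_zero.1 term_eq_zero).resolve_left
    (ENNReal.toReal_ne_zero.2 ⟨(p.mem_support_iff a).1 ha, p.apply_ne_top a⟩)

/-- Markov's inequality, for the complementary event and including the threshold `c = 0`. -/
theorem ofReal_one_sub_le_toOuterMeasure_of_mean_le {p : PMF α} {g : α → ℝ} {b c : ℝ}
    (hg : ∀ a, 0 ≤ g a) (hb : 0 ≤ b) (hc : 0 ≤ c) (hmean : mean p g ≤ b * c) :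
    ENNReal.ofReal (1 - b) ≤ p.toOuterMeasure {a | g a ≤ c} := by
  rcases hc.eq_or_lt with rfl | hc
  · rw [mul_zero] at hmean
    have certain : p.toOuterMeasure {a | g a ≤ 0} = 1 :=
      (PMF.toOuterMeasure_apply_eq_one_iff _ _).2 fun a ha =>
        (apply_eq_zero_of_mean_nonpos hg hmean ha).le
    rw [certain]
    exact ENNReal.ofReal_le_one.2 (sub_le_self 1 hb)
  · rw [toOuterMeasure_eq_ofReal_mean_indicator]
    refine ENNReal.ofReal_le_ofReal ?_
    calc 1 - b ≤ 1 - c⁻¹ * mean p g := by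
          rw [sub_le_sub_iff_left, inv_mul_le_iff₀ hc, mul_comm]
          exact hmean
      _ = mean p fun a => 1 - c⁻¹ * g a := by rw [mean_sub, mean_const, mean_const_mul]
      _ ≤ mean p ({a | g a ≤ c}.indicator 1) := mean_mono fun a => by
          by_cases ha : g a ≤ c
          · simpa [ha] using mul_nonneg (inv_nonneg.2 hc.le) (hg a)
          · simpa [ha, le_inv_mul_iff₀ hc] using (not_le.1 ha).le

end Mean

/-! ### Independent samples -/

section Independence

variable {ι α : Type*} [Fintype ι] [DecidableEq ι] [Fintype α]

theorem toReal_indepPMF (p : ι → PMF α) (X : ι → α) :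
    (indepPMF p X).toReal = ∏ i, (p i (X i)).toReal := by
  rw [indepPMF, PMF.ofFintype_apply, ENNReal.toReal_prod]

theorem toReal_indepPMF_update_mul (p : ι → PMF α) (i : ι) (q : PMF α) (X : ι → α) (a : α) :
    (indepPMF (Function.update p i q) X).toReal * (p i a).toReal =
      (indepPMF p (Function.update X i a)).toReal * (q (X i)).toReal := by
  simp only [toReal_indepPMF, ← Finset.mul_prod_erase _ _ (Finset.mem_univ i),
    Function.update_self]
  have off_i : ∏ j ∈ Finset.univ.erase i, (Function.update p i q j (X j)).toReal =
      ∏ j ∈ Finset.univ.erase i, (p j (Function.update X i a j)).toReal :=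
    Finset.prod_congr rfl fun j hj => by simp [Finset.ne_of_mem_erase hj]
  rw [off_i]
  ring

-- Exchanging the `i`-th coordinate with an independent copy is an involution of `(ι → α) × α`.
theorem mean_indepPMF_update (p : ι → PMF α) (i : ι) (q : PMF α) (φ : (ι → α) → ℝ) :
    mean (indepPMF (Function.update p i q)) φ =
      mean (indepPMF p) fun X => mean q fun a => φ (Function.update X i a) := by
  let swap (z : (ι → α) × α) : (ι → α) × α := (Function.update z.1 i z.2, z.1 i)
  have swap_swap : Function.Involutive swap := fun z => by simp [swap]
  calc mean (indepPMF (Function.update p i q)) φ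
      = ∑ z : (ι → α) × α,
          (indepPMF (Function.update p i q) z.1).toReal * (p i z.2).toReal * φ z.1 := by
        simp only [Fintype.sum_prod_type, ← Finset.sum_mul, ← Finset.mul_sum, sum_toReal_pmf,
          mul_one, mean]
    _ = ∑ z : (ι → α) × α, (indepPMF p (swap z).1).toReal * (q (swap z).2).toReal
          * φ (Function.update (swap z).1 i (swap z).2) := by
        simp [swap, toReal_indepPMF_update_mul]
    _ = ∑ z : (ι → α) × α,
          (indepPMF p z.1).toReal * (q z.2).toReal * φ (Function.update z.1 i z.2) :=
        swap_swap.bijective.sum_comp fun z =>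
          (indepPMF p z.1).toReal * (q z.2).toReal * φ (Function.update z.1 i z.2)
    _ = mean (indepPMF p) fun X => mean q fun a => φ (Function.update X i a) := by
        simp only [Fintype.sum_prod_type, mean, Finset.mul_sum, mul_assoc]

theorem mean_indepPMF_resample (p : ι → PMF α) (i : ι) (φ : (ι → α) → ℝ) :
    mean (indepPMF p) φ =
      mean (indepPMF p) fun X => mean (p i) fun a => φ (Function.update X i a) := by
  rw [← mean_indepPMF_update, Function.update_eq_self]

theorem mean_indepPMF_coord (p : ι → PMF α) (i : ι) (g : α → ℝ) :
    mean (indepPMF p) (fun X => g (X i)) = mean (p i) g := by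
  rw [mean_indepPMF_resample p i]
  simp only [Function.update_self, mean_const]

theorem mean_indepPMF_mul_eq_zero (p : ι → PMF α) {i j : ι} (hij : i ≠ j) {g : α → ℝ}
    (h : α → ℝ) (hg : mean (p i) g = 0) :
    mean (indepPMF p) (fun X => g (X i) * h (X j)) = 0 := by
  rw [mean_indepPMF_resample p i]
  simp only [Function.update_self, Function.update_of_ne hij.symm, mean_mul_const, hg, zero_mul,
    mean_const]

theorem mean_indepPMF_sq_sum (p : ι → PMF α) (s : Finset ι) {g : ι → α → ℝ}
    (hg : ∀ i ∈ s, mean (p i) (g i) = 0) :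
    mean (indepPMF p) (fun X => (∑ i ∈ s, g i (X i)) ^ 2) =
      ∑ i ∈ s, mean (p i) fun a => g i a ^ 2 := by
  simp only [sq, Finset.sum_mul_sum, mean_sum]
  refine Finset.sum_congr rfl fun i hi => ?_
  rw [Finset.sum_eq_single_of_mem i hi fun j _ hj =>
    mean_indepPMF_mul_eq_zero p hj.symm (g j) (hg i hi)]
  exact mean_indepPMF_coord p i fun a => g i a * g i a

theorem mean_abs_average_sub_le (p : ι → PMF α) {s : Finset ι} (hs : s.Nonempty) {g : α → ℝ}
    {μ r : ℝ} (hr : 0 ≤ r) (hμ : ∀ i ∈ s, mean (p i) g = μ) (hg : ∀ a, |g a - μ| ≤ r) :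
    mean (indepPMF p) (fun X => |(∑ i ∈ s, g (X i)) / s.card - μ|) ≤ r / √s.card := by
  have card_pos : (0 : ℝ) < s.card := Nat.cast_pos.2 hs.card_pos
  have centered : ∀ i ∈ s, mean (p i) (fun a => g a - μ) = 0 := fun i hi => by
    rw [mean_sub, hμ i hi, mean_const, sub_self]
  have average_sub (X : ι → α) :
      (∑ i ∈ s, g (X i)) / s.card - μ = (s.card : ℝ)⁻¹ * ∑ i ∈ s, (g (X i) - μ) := by
    rw [Finset.sum_sub_distrib, Finset.sum_const, nsmul_eq_mul]
    field_simp
  have variance_le : ∑ i ∈ s, mean (p i) (fun a => (g a - μ) ^ 2) ≤ s.card * r ^ 2 := by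
    rw [← nsmul_eq_mul]
    exact Finset.sum_le_card_nsmul _ _ _ fun i _ => mean_le_const fun a =>
      sq_le_sq.2 ((hg a).trans (le_abs_self r))
  refine le_of_abs_le (abs_le_of_sq_le_sq ?_ (by positivity))
  calc _ ≤ mean (indepPMF p) fun X => |(∑ i ∈ s, g (X i)) / s.card - μ| ^ 2 := sq_mean_le _ _
    _ = ((s.card : ℝ)⁻¹) ^ 2 * ∑ i ∈ s, mean (p i) fun a => (g a - μ) ^ 2 := by
        simp only [sq_abs, average_sub, mul_pow, mean_const_mul]
        rw [mean_indepPMF_sq_sum p s centered]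
    _ ≤ ((s.card : ℝ)⁻¹) ^ 2 * (s.card * r ^ 2) := by gcongr
    _ = (r / √s.card) ^ 2 := by
        rw [div_pow, Real.sq_sqrt card_pos.le]
        field_simp

end Independence

/-! ### Submodular functions -/

section Submodular

variable {E : Type*} [DecidableEq E] {f : Finset E → ℝ}

/-- Submodularity of a set function, in the union–intersection form. -/
def IsSubmodular (f : Finset E → ℝ) : Prop :=
  ∀ X Y, f (X ∪ Y) + f (X ∩ Y) ≤ f X + f Y

/-- The discrete derivative of a set function in the direction of the element `e`. It does not
depend on whether `e` belongs to the set at which it is taken. -/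
def marginalGain (f : Finset E → ℝ) (e : E) (X : Finset E) : ℝ :=
  f (insert e X) - f (X.erase e)

theorem marginalGain_nonneg (hf : Monotone f) (e : E) (X : Finset E) : 0 ≤ marginalGain f e X :=
  sub_nonneg.2 (hf ((Finset.erase_subset e X).trans (Finset.subset_insert e X)))

theorem IsSubmodular.marginalGain_antitone (hf : IsSubmodular f) (e : E) :
    Antitone (marginalGain f e) := by
  intro X Y hXY
  have union_eq : insert e X ∪ Y.erase e = insert e Y := by grind
  have inter_eq : insert e X ∩ Y.erase e = X.erase e := by grind
  have uncrossed := hf (insert e X) (Y.erase e)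
  rw [union_eq, inter_eq] at uncrossed
  simp only [marginalGain]
  linarith

theorem IsSubmodular.le_add_sum_marginalGain (hf : IsSubmodular f) (hmono : Monotone f)
    (X Z : Finset E) : f Z ≤ f X + ∑ e ∈ Z, marginalGain f e X := by
  refine (hmono (Finset.subset_union_right (s₁ := X))).trans ?_
  induction Z using Finset.induction_on with
  | empty => simp
  | insert a Z ha ih =>
    have gain_le : f (X ∪ insert a Z) - f (X ∪ Z) ≤ marginalGain f a X :=
      calc f (X ∪ insert a Z) - f (X ∪ Z) ≤ marginalGain f a (X ∪ Z) := by
            rw [marginalGain, Finset.union_insert]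
            exact sub_le_sub_left (hmono (Finset.erase_subset a _)) _
        _ ≤ marginalGain f a X := hf.marginalGain_antitone a Finset.subset_union_left
    rw [Finset.sum_insert ha]
    linarith

end Submodular

/-! ### The multilinear extension -/

section Multilinear

variable {E : Type*} [Fintype E] [DecidableEq E]

/-- The multilinear extension `y ↦ 𝔼 g(S^y)` of a set function to the box `[0, 1]^E`. Outside the
box the coins of `randomSubset` truncate `y`. -/
noncomputable def multilinearExt (g : Finset E → ℝ) (y : E → ℝ) : ℝ := mean (randomSubset y) g

theorem mean_coin {x : ℝ} (hx : x ∈ Set.Icc 0 1) (g : Bool → ℝ) :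
    mean (coin x) g = x * g true + (1 - x) * g false := by
  have min_eq : min 1 (ENNReal.ofReal x) = ENNReal.ofReal x :=
    min_eq_right (ENNReal.ofReal_le_one.2 hx.2)
  simp [mean, coin, PMF.ofFintype_apply, min_eq, ENNReal.toReal_ofReal hx.1,
    ENNReal.toReal_sub_of_le (ENNReal.ofReal_le_one.2 hx.2)]

theorem multilinearExt_update (g : Finset E → ℝ) (y : E → ℝ) (e : E) {t : ℝ}
    (ht : t ∈ Set.Icc 0 1) :
    multilinearExt g (Function.update y e t) =
      multilinearExt (fun X => t * g (insert e X) + (1 - t) * g (X.erase e)) y := by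
  have coins_update : (fun i => coin (Function.update y e t i)) =
      Function.update (fun i => coin (y i)) e (coin t) :=
    Function.comp_update coin y e t
  have heads (b : E → Bool) : (Finset.univ.filter fun i => Function.update b e true i = true) =
      insert e (Finset.univ.filter fun i => b i = true) := by
    ext i
    obtain rfl | hi := eq_or_ne i e <;> simp [*]
  have tails (b : E → Bool) : (Finset.univ.filter fun i => Function.update b e false i = true) =
      (Finset.univ.filter fun i => b i = true).erase e := by
    ext i
    obtain rfl | hi := eq_or_ne i e <;> simp [*]
  simp only [multilinearExt, randomSubset, mean_map, coins_update, mean_indepPMF_update,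
    mean_coin ht, heads, tails]

theorem multilinearExt_update_sub (g : Finset E → ℝ) {y : E → ℝ} {e : E} {t : ℝ}
    (hy : y e ∈ Set.Icc 0 1) (ht : t ∈ Set.Icc 0 1) :
    multilinearExt g (Function.update y e t) - multilinearExt g y =
      (t - y e) * multilinearExt (marginalGain g e) y := by
  nth_rw 2 [← Function.update_eq_self e y]
  rw [multilinearExt_update g y e ht, multilinearExt_update g y e hy]
  simp only [multilinearExt, ← mean_sub, ← mean_const_mul, marginalGain]
  exact congrArg _ (funext fun X => by ring)

theorem multilinearExt_indicator_mem {y : E → ℝ} {e : E} (hy : y e ∈ Set.Icc 0 1) :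
    multilinearExt (fun X => if e ∈ X then 1 else 0) y = y e := by
  rw [← Function.update_eq_self e y, multilinearExt_update _ _ _ hy]
  simp [multilinearExt, mean_const]

theorem sum_mul_le_multilinearExt_sub_of_forall_le (g : Finset E → ℝ) {y z c : E → ℝ}
    (hy : 0 ≤ y) (hyz : y ≤ z) (hz : z ≤ 1)
    (hc : ∀ v ∈ Set.Icc y z, ∀ e, c e ≤ multilinearExt (marginalGain g e) v) :
    ∑ e, (z e - y e) * c e ≤ multilinearExt g z - multilinearExt g y := by
  have partial_change (s : Finset E) : ∑ e ∈ s, (z e - y e) * c e ≤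
      multilinearExt g (s.piecewise z y) - multilinearExt g y := by
    induction s using Finset.induction_on with
    | empty => simp
    | insert a s ha ih =>
      have between : s.piecewise z y ∈ Set.Icc y z := Finset.piecewise_mem_Icc_of_mem_of_mem s
        (Set.right_mem_Icc.2 hyz) (Set.left_mem_Icc.2 hyz)
      have step := multilinearExt_update_sub g (y := s.piecewise z y) (e := a) (t := z a)
        ⟨(hy a).trans (between.1 a), (between.2 a).trans (hz a)⟩
        ⟨(hy a).trans (hyz a), hz a⟩
      rw [Finset.piecewise_eq_of_notMem _ _ _ ha] at step
      have rate := mul_le_mul_of_nonneg_left (hc _ between a) (sub_nonneg.2 (hyz a))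
      rw [Finset.sum_insert ha, Finset.piecewise_insert]
      linarith
  simpa using partial_change Finset.univ

theorem multilinearExt_antitone {g : Finset E → ℝ} (hg : Antitone g) {y z : E → ℝ}
    (hy : 0 ≤ y) (hyz : y ≤ z) (hz : z ≤ 1) : multilinearExt g z ≤ multilinearExt g y := by
  have neg_mono : Monotone fun X => -g X := fun X Y hXY => neg_le_neg (hg hXY)
  have increase := sum_mul_le_multilinearExt_sub_of_forall_le (fun X => -g X) (c := 0) hy hyz hz
    fun v _ e => const_le_mean (marginalGain_nonneg neg_mono e)
  simp only [Pi.zero_apply, mul_zero, Finset.sum_const_zero, multilinearExt, mean_neg] at increase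
  simp only [multilinearExt]
  linarith

variable {f : Finset E → ℝ}

theorem multilinearExt_marginalGain_nonneg (hf : Monotone f) (e : E) (y : E → ℝ) :
    0 ≤ multilinearExt (marginalGain f e) y :=
  const_le_mean (marginalGain_nonneg hf e)

theorem IsSubmodular.multilinearExt_marginalGain_le (hf : IsSubmodular f) (e : E) (y : E → ℝ) :
    multilinearExt (marginalGain f e) y ≤ marginalGain f e ∅ :=
  mean_le_const fun X => hf.marginalGain_antitone e (Finset.empty_subset X)

theorem IsSubmodular.le_multilinearExt_add_sum (hf : IsSubmodular f) (hmono : Monotone f)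
    (y : E → ℝ) (Z : Finset E) :
    f Z ≤ multilinearExt f y + ∑ e ∈ Z, multilinearExt (marginalGain f e) y := by
  simp only [multilinearExt]
  rw [← mean_sum, ← mean_add]
  exact const_le_mean fun X => hf.le_add_sum_marginalGain hmono X Z

theorem IsSubmodular.multilinearExt_le_add_sum (hf : IsSubmodular f) (hmono : Monotone f)
    {y : E → ℝ} (hy : y ∈ Set.Icc 0 1) :
    multilinearExt f y ≤ f ∅ + ∑ e, y e * marginalGain f e ∅ := by
  have pointwise (X : Finset E) :
      f X ≤ f ∅ + ∑ e, (if e ∈ X then 1 else 0) * marginalGain f e ∅ := by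
    simpa using hf.le_add_sum_marginalGain hmono ∅ X
  refine (mean_mono pointwise).trans_eq ?_
  rw [mean_const_add, mean_sum]
  exact congrArg _ (Finset.sum_congr rfl fun e _ => by
    rw [mean_mul_const]
    exact congrArg (· * _) (multilinearExt_indicator_mem ⟨hy.1 e, hy.2 e⟩))

-- Concavity of the extension along nonnegative directions.
theorem IsSubmodular.sum_mul_le_multilinearExt_sub (hf : IsSubmodular f) {y z : E → ℝ}
    (hy : 0 ≤ y) (hyz : y ≤ z) (hz : z ≤ 1) :
    ∑ e, (z e - y e) * multilinearExt (marginalGain f e) z ≤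
      multilinearExt f z - multilinearExt f y :=
  sum_mul_le_multilinearExt_sub_of_forall_le f hy hyz hz fun _ hv e =>
    multilinearExt_antitone (hf.marginalGain_antitone e) (hy.trans hv.1) hv.2 hz

end Multilinear

namespace SubmodularMDP

variable {S A : Type*} [DecidableEq S] [DecidableEq A]

theorem isSubmodular (M : SubmodularMDP S A) : IsSubmodular M.f := M.f_submodular

theorem monotone (M : SubmodularMDP S A) : Monotone M.f := fun X Y => M.f_mono X Y

theorem marginalGain_empty_add_le (M : SubmodularMDP S A) {e : S × A} {Z : Finset (S × A)}
    (he : e ∈ Z) : marginalGain M.f e ∅ + M.f ∅ ≤ M.f Z := by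
  simpa [marginalGain] using M.monotone (Finset.singleton_subset_iff.2 he)

/-! ### Trajectories -/

section Trajectories

/-- The law of the set of the next `k` state-action pairs, when the current state is `s` and the
earlier states were `hist`. -/
noncomputable def rolloutSet (M : SubmodularMDP S A) (π : Policy S A) (k : ℕ) (hist : List S)
    (s : S) : PMF (Finset (S × A)) :=
  (M.rollout π k hist s).map List.toFinset

theorem rolloutSet_zero (M : SubmodularMDP S A) (π : Policy S A) (hist : List S) (s : S) :
    M.rolloutSet π 0 hist s = PMF.pure ∅ := by
  rw [rolloutSet, rollout, PMF.pure_map, List.toFinset_nil]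

theorem rolloutSet_succ (M : SubmodularMDP S A) (π : Policy S A) (k : ℕ) (hist : List S) (s : S) :
    M.rolloutSet π (k + 1) hist s = (π (hist ++ [s])).bind fun a => (M.P s a).bind fun s' =>
      (M.rolloutSet π k (hist ++ [s]) s').map (insert (s, a)) := by
  simp only [rolloutSet, rollout, PMF.map_bind, PMF.map_comp, Function.comp_def,
    List.toFinset_cons]

theorem level_add_eq_of_mem_support (M : SubmodularMDP S A) {k : ℕ} {s s' : S} {a : A}
    (hs : M.level s + (k + 1) ≤ M.H) (hs' : s' ∈ (M.P s a).support) (hk : 0 < k) :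
    M.level s' + k = M.level s + (k + 1) := by
  rw [M.level_step s a s' (by omega) hs']
  ring

-- The last transition of an episode is unconstrained, hence the proviso `0 < k`.
theorem map_level_of_mem_support_rollout (M : SubmodularMDP S A) (π : Policy S A) {k : ℕ}
    {hist : List S} {s : S} (hs : 0 < k → M.level s + k ≤ M.H) {tr : List (S × A)}
    (htr : tr ∈ (M.rollout π k hist s).support) :
    tr.map (fun e => M.level e.1) = List.range' (M.level s) k := by
  induction k generalizing hist s tr with
  | zero =>
    rw [rollout, PMF.mem_support_pure_iff] at htr
    rw [htr, List.map_nil, List.range'_zero]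
  | succ k ih =>
    simp only [rollout, PMF.mem_support_bind_iff, PMF.mem_support_map_iff] at htr
    obtain ⟨a, -, s', hs', tail, htail, rfl⟩ := htr
    have hs := hs (Nat.succ_pos k)
    rw [List.map_cons, List.range'_succ,
      ih (fun hk => (M.level_add_eq_of_mem_support hs hs' hk).trans_le hs) htail]
    rcases k.eq_zero_or_pos with rfl | hk
    · simp only [List.range'_zero]
    · have := M.level_add_eq_of_mem_support hs hs' hk
      rw [show M.level s' = M.level s + 1 by omega]

theorem notMem_of_mem_support_rolloutSet (M : SubmodularMDP S A) (π : Policy S A) {k : ℕ}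
    {hist : List S} {s s' : S} {a : A} (hs : M.level s + (k + 1) ≤ M.H)
    (hs' : s' ∈ (M.P s a).support) {Z : Finset (S × A)}
    (hZ : Z ∈ (M.rolloutSet π k hist s').support) : (s, a) ∉ Z := by
  obtain ⟨tr, htr, rfl⟩ := (PMF.mem_support_map_iff _ _ _).1 hZ
  intro hmem
  have level_mem : M.level s ∈ List.range' (M.level s') k := by
    rw [← M.map_level_of_mem_support_rollout π
      (fun hk => (M.level_add_eq_of_mem_support hs hs' hk).trans_le hs) htr]
    exact List.mem_map_of_mem (f := fun e => M.level e.1) (List.mem_toFinset.1 hmem)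
  have := List.mem_range'_1.1 level_mem
  have := M.level_add_eq_of_mem_support hs hs' (by omega)
  omega

theorem length_of_mem_support_trajectory (M : SubmodularMDP S A) (π : Policy S A)
    {tr : List (S × A)} (htr : tr ∈ (M.trajectory π).support) : tr.length = M.H := by
  have levels := M.map_level_of_mem_support_rollout π (fun _ => by simp [M.level_init]) htr
  simpa using congrArg List.length levels

theorem card_mem_Icc_of_mem_support_visited (M : SubmodularMDP S A) (π : Policy S A)
    {Z : Finset (S × A)} (hZ : Z ∈ (M.visited π).support) : Z.card ∈ Set.Icc 1 M.H := by
  obtain ⟨tr, htr, rfl⟩ := (PMF.mem_support_map_iff _ _ _).1 hZ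
  have length_eq := M.length_of_mem_support_trajectory π htr
  refine ⟨?_, length_eq ▸ tr.toFinset_card_le⟩
  rw [Nat.one_le_iff_ne_zero, Finset.card_ne_zero, List.toFinset_nonempty_iff,
    ← List.length_pos_iff, length_eq]
  exact M.H_pos

end Trajectories

/-! ### Values and marginals of policies -/

section Values

variable [Fintype S] [Fintype A]

theorem marginal_eq_mean (M : SubmodularMDP S A) (π : Policy S A) (e : S × A) :
    M.marginal π e = mean (M.visited π) fun Z => if e ∈ Z then 1 else 0 := by
  simp only [marginal, mean, Finset.sum_filter, mul_ite, mul_one, mul_zero]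

theorem marginal_nonneg (M : SubmodularMDP S A) (π : Policy S A) (e : S × A) :
    0 ≤ M.marginal π e :=
  Finset.sum_nonneg fun _ _ => ENNReal.toReal_nonneg

theorem marginal_le_one (M : SubmodularMDP S A) (π : Policy S A) (e : S × A) :
    M.marginal π e ≤ 1 := by
  rw [marginal_eq_mean]
  exact mean_le_const fun Z => by split_ifs <;> norm_num

/-- The inner product `x(π) · w`, the expected total of the additive reward `w`. -/
noncomputable def additiveValue (M : SubmodularMDP S A) (π : Policy S A) (w : S × A → ℝ) : ℝ :=
  ∑ e, M.marginal π e * w e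

theorem additiveValue_eq_mean (M : SubmodularMDP S A) (π : Policy S A) (w : S × A → ℝ) :
    M.additiveValue π w = mean (M.visited π) fun Z => ∑ e ∈ Z, w e := by
  simp only [additiveValue, marginal_eq_mean, ← mean_mul_const, ← mean_sum, ite_mul, one_mul,
    zero_mul, Finset.sum_ite_mem, Finset.univ_inter]

theorem value_nonneg (M : SubmodularMDP S A) (π : Policy S A) : 0 ≤ M.value π :=
  const_le_mean M.f_nonneg

theorem randomValue_nonneg (M : SubmodularMDP S A) (ρ : PMF (Policy S A)) :
    0 ≤ M.randomValue ρ :=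
  const_le_mean M.f_nonneg

theorem value_le_univ (M : SubmodularMDP S A) (π : Policy S A) : M.value π ≤ M.f Finset.univ :=
  mean_le_const fun Z => M.monotone (Finset.subset_univ Z)

theorem marginal_mul_marginalGain_le_value (M : SubmodularMDP S A) (π : Policy S A) (e : S × A) :
    M.marginal π e * marginalGain M.f e ∅ ≤ M.value π := by
  rw [marginal_eq_mean, ← mean_mul_const]
  refine mean_mono fun Z => ?_
  split_ifs with he
  · linarith [M.marginalGain_empty_add_le he, M.f_nonneg ∅]
  · simpa using M.f_nonneg Z

theorem value_le_multilinearExt_add (M : SubmodularMDP S A) (π : Policy S A) (y : S × A → ℝ) :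
    M.value π ≤ multilinearExt M.f y +
      M.additiveValue π fun e => multilinearExt (marginalGain M.f e) y := by
  rw [additiveValue_eq_mean, ← mean_const_add]
  exact mean_mono (M.isSubmodular.le_multilinearExt_add_sum M.monotone y)

-- A trajectory contains at most `H` pairs, and each of them is worth at most the whole of it.
theorem add_additiveValue_le_horizon_mul_value (M : SubmodularMDP S A) (π : Policy S A) :
    M.f ∅ + M.additiveValue π (fun e => marginalGain M.f e ∅) ≤ M.H * M.value π := by
  rw [additiveValue_eq_mean, ← mean_const_add, value, expect, ← mean, ← mean_const_mul]
  refine mean_le_mean_of_support fun Z hZ => ?_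
  obtain ⟨one_le_card, card_le⟩ := M.card_mem_Icc_of_mem_support_visited π hZ
  calc M.f ∅ + ∑ e ∈ Z, marginalGain M.f e ∅
      ≤ Z.card * M.f ∅ + ∑ e ∈ Z, marginalGain M.f e ∅ := by
        gcongr
        exact le_mul_of_one_le_left (M.f_nonneg ∅) (Nat.one_le_cast.2 one_le_card)
    _ = ∑ e ∈ Z, (marginalGain M.f e ∅ + M.f ∅) := by
        rw [Finset.sum_add_distrib, Finset.sum_const, nsmul_eq_mul, add_comm]
    _ ≤ Z.card * M.f Z := by
        rw [← nsmul_eq_mul]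
        exact Finset.sum_le_card_nsmul _ _ _ fun e he => M.marginalGain_empty_add_le he
    _ ≤ M.H * M.f Z := by
        gcongr
        exact M.f_nonneg Z

end Values

/-! ### Dynamic programming -/

section BackwardInduction

variable [Fintype S] [Fintype A]

/-- The expected total of the additive reward `w` over the next `k` steps under the policy `π`,
when the current state is `s` and the earlier states were `hist`. -/
noncomputable def rewardToGo (M : SubmodularMDP S A) (π : Policy S A) (w : S × A → ℝ) (k : ℕ)
    (hist : List S) (s : S) : ℝ :=
  mean (M.rolloutSet π k hist s) fun Z => ∑ e ∈ Z, w e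

theorem additiveValue_eq_rewardToGo (M : SubmodularMDP S A) (π : Policy S A) (w : S × A → ℝ) :
    M.additiveValue π w = M.rewardToGo π w M.H [] M.s₁ :=
  M.additiveValue_eq_mean π w

theorem rewardToGo_zero (M : SubmodularMDP S A) (π : Policy S A) (w : S × A → ℝ) (hist : List S)
    (s : S) : M.rewardToGo π w 0 hist s = 0 := by
  rw [rewardToGo, rolloutSet_zero, mean_pure, Finset.sum_empty]

theorem rewardToGo_succ (M : SubmodularMDP S A) (π : Policy S A) (w : S × A → ℝ) {k : ℕ}
    (hist : List S) {s : S} (hs : M.level s + (k + 1) ≤ M.H) :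
    M.rewardToGo π w (k + 1) hist s = mean (π (hist ++ [s])) fun a =>
      w (s, a) + mean (M.P s a) (M.rewardToGo π w k (hist ++ [s])) := by
  rw [rewardToGo, rolloutSet_succ, mean_bind]
  congr 1 with a
  rw [mean_bind, ← mean_const_add]
  refine mean_congr_of_support fun s' hs' => ?_
  rw [mean_map, rewardToGo, ← mean_const_add]
  exact mean_congr_of_support fun Z hZ =>
    Finset.sum_insert (M.notMem_of_mem_support_rolloutSet π hs hs' hZ)

variable [Nonempty A]

theorem dpQ_le_dpValue (M : SubmodularMDP S A) (w : S × A → ℝ) (k : ℕ) (s : S) (a : A) :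
    M.dpQ w k s a ≤ M.dpValue w (k + 1) s :=
  Finset.le_sup' (M.dpQ w k s) (Finset.mem_univ a)

theorem dpQ_eq_dpValue_of_forall_le (M : SubmodularMDP S A) (w : S × A → ℝ) (k : ℕ) (s : S)
    {a : A} (ha : ∀ b, M.dpQ w k s b ≤ M.dpQ w k s a) :
    M.dpQ w k s a = M.dpValue w (k + 1) s :=
  (M.dpQ_le_dpValue w k s a).antisymm (Finset.sup'_le _ _ fun b _ => ha b)

theorem rewardToGo_le_dpValue (M : SubmodularMDP S A) (π : Policy S A) (w : S × A → ℝ) {k : ℕ}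
    (hist : List S) {s : S} (hs : 0 < k → M.level s + k ≤ M.H) :
    M.rewardToGo π w k hist s ≤ M.dpValue w k s := by
  induction k generalizing hist s with
  | zero => exact (M.rewardToGo_zero π w hist s).le
  | succ k ih =>
    have hs := hs (Nat.succ_pos k)
    rw [M.rewardToGo_succ π w hist hs]
    refine mean_le_const fun a => le_trans ?_ (M.dpQ_le_dpValue w k s a)
    exact add_le_add_right (mean_le_mean_of_support fun s' hs' =>
      ih _ fun hk => (M.level_add_eq_of_mem_support hs hs' hk).trans_le hs) _

theorem rewardToGo_dpPolicy (M : SubmodularMDP S A) {arg : S → (A → ℝ) → A}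
    (harg : ∀ s (q : A → ℝ) a, q a ≤ q (arg s q)) (w : S × A → ℝ) {k : ℕ} (hist : List S) {s : S}
    (hs : 0 < k → M.level s + k = M.H) :
    M.rewardToGo (M.ofDet (M.dpPolicy arg w)) w k hist s = M.dpValue w k s := by
  induction k generalizing hist s with
  | zero => exact M.rewardToGo_zero _ w hist s
  | succ k ih =>
    have hs := hs (Nat.succ_pos k)
    have action_eq : M.dpPolicy arg w s = arg s (M.dpQ w k s) := by
      rw [dpPolicy, show M.H - 1 - M.level s = k by omega]
    have tail_eq (a : A) : mean (M.P s a) (M.rewardToGo (M.ofDet (M.dpPolicy arg w)) w k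
        (hist ++ [s])) = mean (M.P s a) (M.dpValue w k) :=
      mean_congr_of_support fun s' hs' =>
        ih _ fun hk => (M.level_add_eq_of_mem_support hs.le hs' hk).trans hs
    rw [M.rewardToGo_succ _ w hist hs.le, ofDet, mean_pure, List.getLastD_concat, action_eq]
    simp only [tail_eq]
    exact M.dpQ_eq_dpValue_of_forall_le w k s (harg s (M.dpQ w k s))

theorem additiveValue_le_dpValue (M : SubmodularMDP S A) (π : Policy S A) (w : S × A → ℝ) :
    M.additiveValue π w ≤ M.dpValue w M.H M.s₁ := by
  rw [additiveValue_eq_rewardToGo]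
  exact M.rewardToGo_le_dpValue π w [] fun _ => by rw [M.level_init, zero_add]

theorem additiveValue_dpPolicy (M : SubmodularMDP S A) {arg : S → (A → ℝ) → A}
    (harg : ∀ s (q : A → ℝ) a, q a ≤ q (arg s q)) (w : S × A → ℝ) :
    M.additiveValue (M.ofDet (M.dpPolicy arg w)) w = M.dpValue w M.H M.s₁ := by
  rw [additiveValue_eq_rewardToGo]
  exact M.rewardToGo_dpPolicy harg w [] fun _ => by rw [M.level_init, zero_add]

end BackwardInduction

end SubmodularMDP

/-! ### Parameters of the algorithm -/

section Parameters

variable (S A : Type*) [Fintype S] [Fintype A]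

theorem stepSize_nonneg : 0 ≤ stepSize S A := by
  rw [stepSize]
  positivity

theorem numSteps_mul_stepSize [Nonempty S] [Nonempty A] :
    (numSteps S A : ℝ) * stepSize S A = 1 := by
  rw [numSteps, stepSize]
  push_cast
  exact mul_one_div_cancel (by simp)

theorem numSteps_pos [Nonempty S] [Nonempty A] : 0 < numSteps S A := by
  have := numSteps_mul_stepSize S A
  exact Nat.pos_of_ne_zero fun h => by simp [h] at this

theorem stepSize_pos [Nonempty S] [Nonempty A] : 0 < stepSize S A := by
  have := numSteps_mul_stepSize S A
  exact (stepSize_nonneg S A).lt_of_ne fun h => by simp [← h] at this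

theorem stepSize_le_one [Nonempty S] [Nonempty A] : stepSize S A ≤ 1 := by
  rw [← numSteps_mul_stepSize S A]
  exact le_mul_of_one_le_left (stepSize_nonneg S A) (Nat.one_le_cast.2 (numSteps_pos S A))

theorem stepSize_mul_card [Nonempty S] [Nonempty A] :
    stepSize S A * Fintype.card (S × A) = 1 / (9 * Fintype.card (S × A)) := by
  rw [stepSize, Fintype.card_prod]
  push_cast
  field_simp

theorem one_sub_stepSize_pow_numSteps_le [Nonempty S] [Nonempty A] :
    (1 - stepSize S A) ^ numSteps S A ≤ 1 / Real.exp 1 :=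
  calc (1 - stepSize S A) ^ numSteps S A ≤ Real.exp (-stepSize S A) ^ numSteps S A :=
        pow_le_pow_left₀ (sub_nonneg.2 (stepSize_le_one S A)) (Real.one_sub_le_exp_neg _) _
    _ = 1 / Real.exp 1 := by
        rw [← Real.exp_nat_mul, mul_neg, numSteps_mul_stepSize, Real.exp_neg, one_div]

theorem inv_sq_stepSize_le_numSamples [Nonempty S] [Nonempty A] :
    (stepSize S A ^ 2)⁻¹ ≤ numSamples S A := by
  have log_nonneg : 0 ≤ Real.log ((Fintype.card S : ℝ) * Fintype.card A) := by
    exact_mod_cast Real.log_natCast_nonneg (Fintype.card S * Fintype.card A)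
  refine le_trans ?_ (Nat.le_ceil _)
  rw [inv_eq_one_div]
  gcongr
  linarith

theorem numSamples_pos [Nonempty S] [Nonempty A] : 0 < numSamples S A :=
  Nat.cast_pos.1 ((inv_pos.2 (pow_pos (stepSize_pos S A) 2)).trans_le
    (inv_sq_stepSize_le_numSamples S A))

theorem inv_sqrt_numSamples_le_stepSize [Nonempty S] [Nonempty A] :
    (√(numSamples S A))⁻¹ ≤ stepSize S A := by
  refine inv_le_of_inv_le₀ (stepSize_pos S A) (Real.le_sqrt_of_sq_le ?_)
  rw [inv_pow]
  exact inv_sq_stepSize_le_numSamples S A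

end Parameters

namespace SubmodularMDP

variable {S A : Type*} [DecidableEq S] [DecidableEq A] [Fintype S] [Fintype A]

/-! ### The optimum -/

section Optimum

/-- The supremum of the values of all policies. -/
noncomputable def optValue (M : SubmodularMDP S A) : ℝ := ⨆ π, M.value π

/-- The largest probability with which any policy visits `e`. -/
noncomputable def maxMarginal (M : SubmodularMDP S A) (e : S × A) : ℝ := ⨆ π, M.marginal π e

theorem value_le_optValue (M : SubmodularMDP S A) (π : Policy S A) : M.value π ≤ M.optValue :=
  le_ciSup ⟨_, Set.forall_mem_range.2 M.value_le_univ⟩ π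

theorem optValue_nonneg (M : SubmodularMDP S A) : 0 ≤ M.optValue :=
  Real.iSup_nonneg M.value_nonneg

theorem marginal_le_maxMarginal (M : SubmodularMDP S A) (π : Policy S A) (e : S × A) :
    M.marginal π e ≤ M.maxMarginal e :=
  le_ciSup (f := fun π => M.marginal π e) ⟨1, Set.forall_mem_range.2 (M.marginal_le_one · e)⟩ π

theorem maxMarginal_nonneg (M : SubmodularMDP S A) (e : S × A) : 0 ≤ M.maxMarginal e :=
  Real.iSup_nonneg (M.marginal_nonneg · e)

theorem sum_maxMarginal_mul_marginalGain_le (M : SubmodularMDP S A) :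
    ∑ e, M.maxMarginal e * marginalGain M.f e ∅ ≤ Fintype.card (S × A) * M.optValue := by
  rw [← nsmul_eq_mul]
  refine Finset.sum_le_card_nsmul _ _ _ fun e _ => ?_
  rw [maxMarginal, Real.iSup_mul_of_nonneg (marginalGain_nonneg M.monotone e ∅)]
  exact Real.iSup_le (fun π => (M.marginal_mul_marginalGain_le_value π e).trans
    (M.value_le_optValue π)) M.optValue_nonneg

end Optimum

/-! ### Progress of one greedy step -/

section Progress

/-- The gradient of the multilinear extension of the objective. -/
noncomputable def gradient (M : SubmodularMDP S A) (y : S × A → ℝ) (e : S × A) : ℝ :=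
  multilinearExt (marginalGain M.f e) y

theorem gradient_nonneg (M : SubmodularMDP S A) (y : S × A → ℝ) (e : S × A) :
    0 ≤ M.gradient y e :=
  multilinearExt_marginalGain_nonneg M.monotone e y

theorem gradient_le (M : SubmodularMDP S A) (y : S × A → ℝ) (e : S × A) :
    M.gradient y e ≤ marginalGain M.f e ∅ :=
  M.isSubmodular.multilinearExt_marginalGain_le e y

theorem gradient_antitone (M : SubmodularMDP S A) {y z : S × A → ℝ} (hy : 0 ≤ y) (hyz : y ≤ z)
    (hz : z ≤ 1) : M.gradient z ≤ M.gradient y := fun e =>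
  multilinearExt_antitone (M.isSubmodular.marginalGain_antitone e) hy hyz hz

/-- The decrease of the gradient from the origin to `y`, where the coordinate `e` is weighted by
`maxMarginal e`. It grows along the run of the algorithm and absorbs the discretization errors. -/
noncomputable def gradientDrop (M : SubmodularMDP S A) (y : S × A → ℝ) : ℝ :=
  ∑ e, M.maxMarginal e * (marginalGain M.f e ∅ - M.gradient y e)

theorem gradientDrop_nonneg (M : SubmodularMDP S A) (y : S × A → ℝ) : 0 ≤ M.gradientDrop y :=
  Finset.sum_nonneg fun e _ =>
    mul_nonneg (M.maxMarginal_nonneg e) (sub_nonneg.2 (M.gradient_le y e))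

theorem gradientDrop_le (M : SubmodularMDP S A) (y : S × A → ℝ) :
    M.gradientDrop y ≤ Fintype.card (S × A) * M.optValue :=
  (Finset.sum_le_sum fun e _ => mul_le_mul_of_nonneg_left
    (sub_le_self _ (M.gradient_nonneg y e)) (M.maxMarginal_nonneg e)).trans
    M.sum_maxMarginal_mul_marginalGain_le

theorem additiveValue_gradient_sub_le (M : SubmodularMDP S A) (π : Policy S A)
    {y z : S × A → ℝ} (hyz : M.gradient z ≤ M.gradient y) :
    M.additiveValue π (M.gradient y) - M.additiveValue π (M.gradient z) ≤
      M.gradientDrop z - M.gradientDrop y := by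
  simp only [additiveValue, gradientDrop, ← Finset.sum_sub_distrib, ← mul_sub,
    sub_sub_sub_cancel_left]
  exact Finset.sum_le_sum fun e _ =>
    mul_le_mul_of_nonneg_right (M.marginal_le_maxMarginal π e) (sub_nonneg.2 (hyz e))

theorem mul_additiveValue_le_multilinearExt_sub (M : SubmodularMDP S A) {y : S × A → ℝ}
    (π : Policy S A) {δ : ℝ} (hy : 0 ≤ y) (hδ : 0 ≤ δ) (hz : y + δ • M.marginal π ≤ 1) :
    δ * M.additiveValue π (M.gradient (y + δ • M.marginal π)) ≤
      multilinearExt M.f (y + δ • M.marginal π) - multilinearExt M.f y := by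
  have hyz : y ≤ y + δ • M.marginal π :=
    le_add_of_nonneg_right (smul_nonneg hδ (M.marginal_nonneg π))
  have concave := M.isSubmodular.sum_mul_le_multilinearExt_sub hy hyz hz
  simp only [Pi.add_apply, Pi.smul_apply, smul_eq_mul, add_sub_cancel_left, mul_assoc,
    ← Finset.mul_sum] at concave
  exact concave

variable [Nonempty A]

/-- The amount by which `π` misses the optimum for the additive reward `w`. -/
noncomputable def additiveLoss (M : SubmodularMDP S A) (w : S × A → ℝ) (π : Policy S A) : ℝ :=
  M.dpValue w M.H M.s₁ - M.additiveValue π w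

theorem additiveLoss_nonneg (M : SubmodularMDP S A) (w : S × A → ℝ) (π : Policy S A) :
    0 ≤ M.additiveLoss w π :=
  sub_nonneg.2 (M.additiveValue_le_dpValue π w)

theorem optValue_le_multilinearExt_add_dpValue (M : SubmodularMDP S A) (y : S × A → ℝ) :
    M.optValue ≤ multilinearExt M.f y + M.dpValue (M.gradient y) M.H M.s₁ :=
  ciSup_le fun π => (M.value_le_multilinearExt_add π y).trans
    (add_le_add_right (M.additiveValue_le_dpValue π (M.gradient y)) _)

theorem optValue_sub_multilinearExt_add_smul_le (M : SubmodularMDP S A) {y : S × A → ℝ}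
    (π : Policy S A) {δ : ℝ} (hy : 0 ≤ y) (hδ : 0 ≤ δ) (hz : y + δ • M.marginal π ≤ 1) :
    M.optValue - multilinearExt M.f (y + δ • M.marginal π) ≤
      (1 - δ) * (M.optValue - multilinearExt M.f y) + δ * M.additiveLoss (M.gradient y) π +
        δ * (M.gradientDrop (y + δ • M.marginal π) - M.gradientDrop y) := by
  have hyz : y ≤ y + δ • M.marginal π :=
    le_add_of_nonneg_right (smul_nonneg hδ (M.marginal_nonneg π))
  have ascent := M.mul_additiveValue_le_multilinearExt_sub π hy hδ hz
  have drop := mul_le_mul_of_nonneg_left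
    (M.additiveValue_gradient_sub_le π (M.gradient_antitone hy hyz hz)) hδ
  have linearized := mul_le_mul_of_nonneg_left (M.optValue_le_multilinearExt_add_dpValue y) hδ
  rw [additiveLoss]
  linarith

end Progress

/-! ### The run of the algorithm -/

section Run

theorem position_succ (M : SubmodularMDP S A) {k : ℕ} (d : Fin (k + 1) → S → A) :
    M.position d =
      M.position (Fin.init d) + stepSize S A • M.marginal (M.ofDet (d (Fin.last k))) :=
  funext fun _ => Fin.sum_univ_castSucc _

theorem position_nonneg (M : SubmodularMDP S A) {k : ℕ} (d : Fin k → S → A) :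
    0 ≤ M.position d := fun e =>
  Finset.sum_nonneg fun _ _ => mul_nonneg (stepSize_nonneg S A) (M.marginal_nonneg _ e)

variable [Nonempty A]

theorem position_le_one (M : SubmodularMDP S A) {k : ℕ} (hk : k ≤ numSteps S A)
    (d : Fin k → S → A) : M.position d ≤ 1 := fun e => by
  have : Nonempty S := ⟨M.s₁⟩
  calc M.position d e ≤ ∑ _i : Fin k, stepSize S A :=
        Finset.sum_le_sum fun i _ =>
          mul_le_of_le_one_right (stepSize_nonneg S A) (M.marginal_le_one _ e)
    _ = k * stepSize S A := by rw [Finset.sum_const, Finset.card_fin, nsmul_eq_mul]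
    _ ≤ numSteps S A * stepSize S A :=
        mul_le_mul_of_nonneg_right (Nat.cast_le.2 hk) (stepSize_nonneg S A)
    _ = 1 := numSteps_mul_stepSize S A

/-- The accumulated loss of the policies `d 0, …, d (k - 1)` against exact maximization of the
linearized objective in each step. -/
noncomputable def regret (M : SubmodularMDP S A) : (k : ℕ) → (Fin k → S → A) → ℝ
  | 0, _ => 0
  | k + 1, d => M.regret k (Fin.init d) + stepSize S A *
      M.additiveLoss (M.gradient (M.position (Fin.init d))) (M.ofDet (d (Fin.last k)))

theorem regret_nonneg (M : SubmodularMDP S A) (k : ℕ) (d : Fin k → S → A) :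
    0 ≤ M.regret k d := by
  induction k with
  | zero => exact le_rfl
  | succ k ih =>
    exact add_nonneg (ih _) (mul_nonneg (stepSize_nonneg S A) (M.additiveLoss_nonneg _ _))

theorem optValue_sub_multilinearExt_position_le (M : SubmodularMDP S A) {k : ℕ}
    (hk : k ≤ numSteps S A) (d : Fin k → S → A) :
    M.optValue - multilinearExt M.f (M.position d) ≤
      (1 - stepSize S A) ^ k * M.optValue + M.regret k d +
        stepSize S A * M.gradientDrop (M.position d) := by
  have : Nonempty S := ⟨M.s₁⟩
  have hδ := stepSize_nonneg S A
  induction k with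
  | zero =>
    have ext_nonneg : 0 ≤ multilinearExt M.f (M.position d) := const_le_mean M.f_nonneg
    have drop_nonneg := mul_nonneg hδ (M.gradientDrop_nonneg (M.position d))
    rw [pow_zero, regret]
    linarith
  | succ k ih =>
    have hz := M.position_le_one hk d
    have induced := mul_le_mul_of_nonneg_left (ih (Nat.le_of_succ_le hk) (Fin.init d))
      (sub_nonneg.2 (stepSize_le_one S A))
    have regret_nonneg := mul_nonneg hδ (M.regret_nonneg k (Fin.init d))
    have drop_nonneg :=
      mul_nonneg hδ (mul_nonneg hδ (M.gradientDrop_nonneg (M.position (Fin.init d))))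
    rw [position_succ] at hz ⊢
    have step := M.optValue_sub_multilinearExt_add_smul_le _ (M.position_nonneg _) hδ hz
    rw [regret, pow_succ']
    linarith

theorem randomValue_mixture (M : SubmodularMDP S A) (d : Fin (numSteps S A) → S → A) :
    M.randomValue (M.mixture d) = ∑ t, stepSize S A * M.value (M.ofDet (d t)) := by
  have : Nonempty S := ⟨M.s₁⟩
  have : NeZero (numSteps S A) := ⟨(numSteps_pos S A).ne'⟩
  have weight_eq : ((numSteps S A : ℝ))⁻¹ = stepSize S A :=
    (eq_inv_of_mul_eq_one_right (numSteps_mul_stepSize S A)).symm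
  rw [randomValue, expect, ← mean, mixture, PMF.bind_map, mean_bind, mean]
  simp only [PMF.uniformOfFintype_apply, Fintype.card_fin, ENNReal.toReal_inv,
    ENNReal.toReal_natCast, weight_eq]
  rfl

theorem multilinearExt_position_le_horizon_mul_randomValue (M : SubmodularMDP S A)
    (d : Fin (numSteps S A) → S → A) :
    multilinearExt M.f (M.position d) ≤ M.H * M.randomValue (M.mixture d) := by
  have : Nonempty S := ⟨M.s₁⟩
  calc multilinearExt M.f (M.position d)
      ≤ M.f ∅ + ∑ e, M.position d e * marginalGain M.f e ∅ :=
        M.isSubmodular.multilinearExt_le_add_sum M.monotone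
          ⟨M.position_nonneg d, M.position_le_one le_rfl d⟩
    _ = ∑ t, stepSize S A *
          (M.f ∅ + M.additiveValue (M.ofDet (d t)) fun e => marginalGain M.f e ∅) := by
        simp only [mul_add, Finset.sum_add_distrib, Finset.sum_const, Finset.card_univ,
          Fintype.card_fin, nsmul_eq_mul, ← mul_assoc, numSteps_mul_stepSize, one_mul, position,
          additiveValue, Finset.sum_mul, Finset.mul_sum]
        rw [Finset.sum_comm]
    _ ≤ ∑ t, stepSize S A * (M.H * M.value (M.ofDet (d t))) :=
        Finset.sum_le_sum fun t _ => mul_le_mul_of_nonneg_left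
          (M.add_additiveValue_le_horizon_mul_value _) (stepSize_nonneg S A)
    _ = M.H * M.randomValue (M.mixture d) := by
        simp only [randomValue_mixture, Finset.mul_sum, mul_left_comm]

theorem mul_value_le_horizon_mul_randomValue (M : SubmodularMDP S A)
    {d : Fin (numSteps S A) → S → A} {c : ℝ} (hd : M.regret _ d ≤ c * M.optValue)
    (π : Policy S A) :
    (1 - 1 / Real.exp 1 - (stepSize S A * Fintype.card (S × A) + c)) * M.value π ≤
      M.H * M.randomValue (M.mixture d) := by
  have : Nonempty S := ⟨M.s₁⟩
  rcases le_total 0 (1 - 1 / Real.exp 1 - (stepSize S A * Fintype.card (S × A) + c)) with hc | hc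
  · have progress := M.optValue_sub_multilinearExt_position_le le_rfl d
    have decay := mul_le_mul_of_nonneg_right (one_sub_stepSize_pow_numSteps_le S A)
      M.optValue_nonneg
    have drop := mul_le_mul_of_nonneg_left (M.gradientDrop_le (M.position d))
      (stepSize_nonneg S A)
    refine (mul_le_mul_of_nonneg_left (M.value_le_optValue π) hc).trans ?_
    refine le_trans ?_ (M.multilinearExt_position_le_horizon_mul_randomValue d)
    linarith
  · exact (mul_nonpos_of_nonpos_of_nonneg hc (M.value_nonneg π)).trans
      (mul_nonneg (Nat.cast_nonneg _) (M.randomValue_nonneg _))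

end Run

/-! ### Sampling errors -/

section Sampling

variable [Nonempty A]

theorem additiveLoss_dpPolicy_le (M : SubmodularMDP S A) {arg : S → (A → ℝ) → A}
    (harg : ∀ s (q : A → ℝ) a, q a ≤ q (arg s q)) (g w : S × A → ℝ) :
    M.additiveLoss g (M.ofDet (M.dpPolicy arg w)) ≤ ∑ e, M.maxMarginal e * |w e - g e| := by
  set πg := M.ofDet (M.dpPolicy arg g)
  set πw := M.ofDet (M.dpPolicy arg w)
  have optimal_for_w : M.additiveValue πg w ≤ M.additiveValue πw w :=
    (M.additiveValue_le_dpValue πg w).trans_eq (M.additiveValue_dpPolicy harg w).symm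
  have weight_le (e : S × A) : |M.marginal πw e - M.marginal πg e| ≤ M.maxMarginal e :=
    abs_sub_le_of_nonneg_of_le (M.marginal_nonneg _ e) (M.marginal_le_maxMarginal _ e)
      (M.marginal_nonneg _ e) (M.marginal_le_maxMarginal _ e)
  calc M.additiveLoss g πw
      ≤ M.additiveValue πg g - M.additiveValue πw g +
          (M.additiveValue πw w - M.additiveValue πg w) := by
        rw [additiveLoss, ← M.additiveValue_dpPolicy harg g]
        exact le_add_of_nonneg_right (sub_nonneg.2 optimal_for_w)
    _ = ∑ e, (M.marginal πw e - M.marginal πg e) * (w e - g e) := by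
        simp only [additiveValue, ← Finset.sum_sub_distrib, ← Finset.sum_add_distrib]
        exact Finset.sum_congr rfl fun e _ => by ring
    _ ≤ ∑ e, M.maxMarginal e * |w e - g e| := Finset.sum_le_sum fun e _ =>
        (le_abs_self _).trans ((abs_mul _ _).trans_le
          (mul_le_mul_of_nonneg_right (weight_le e) (abs_nonneg _)))

theorem mean_abs_estimate_sub_gradient_le (M : SubmodularMDP S A) (y : S × A → ℝ) (e : S × A) :
    mean (indepPMF fun _ : (S × A) × Fin (numSamples S A) => randomSubset y)
        (fun X => |(∑ r, marginalGain M.f e (X (e, r))) / numSamples S A - M.gradient y e|) ≤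
      stepSize S A * marginalGain M.f e ∅ := by
  have : Nonempty S := ⟨M.s₁⟩
  have : NeZero (numSamples S A) := ⟨(numSamples_pos S A).ne'⟩
  have gain_nonneg := marginalGain_nonneg M.monotone e
  have deviation := mean_abs_average_sub_le
    (fun _ : (S × A) × Fin (numSamples S A) => randomSubset y)
    (s := {e} ×ˢ Finset.univ) (by simp) (gain_nonneg ∅) (fun _ _ => rfl) fun X =>
      abs_sub_le_of_nonneg_of_le (gain_nonneg X)
        (M.isSubmodular.marginalGain_antitone e (Finset.empty_subset X))
        (M.gradient_nonneg y e) (M.gradient_le y e)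
  simp only [Finset.sum_product, Finset.sum_singleton, Finset.card_product, Finset.card_singleton,
    Finset.card_univ, Fintype.card_fin, one_mul] at deviation
  refine deviation.trans ?_
  rw [div_eq_mul_inv, mul_comm]
  exact mul_le_mul_of_nonneg_right (inv_sqrt_numSamples_le_stepSize S A) (gain_nonneg ∅)

theorem mean_additiveLoss_dpPolicy_le (M : SubmodularMDP S A) {arg : S → (A → ℝ) → A}
    (harg : ∀ s (q : A → ℝ) a, q a ≤ q (arg s q)) (y : S × A → ℝ) :
    mean ((M.gradientEstimate y).map (M.dpPolicy arg))
        (fun d => M.additiveLoss (M.gradient y) (M.ofDet d)) ≤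
      stepSize S A * Fintype.card (S × A) * M.optValue := by
  rw [gradientEstimate, PMF.map_comp, mean_map]
  refine (mean_mono fun X => M.additiveLoss_dpPolicy_le harg _ _).trans ?_
  simp only [mean_sum, mean_const_mul]
  calc _ ≤ ∑ e, M.maxMarginal e * (stepSize S A * marginalGain M.f e ∅) :=
        Finset.sum_le_sum fun e _ => mul_le_mul_of_nonneg_left
          (M.mean_abs_estimate_sub_gradient_le y e) (M.maxMarginal_nonneg e)
    _ = stepSize S A * ∑ e, M.maxMarginal e * marginalGain M.f e ∅ := by
        simp only [Finset.mul_sum, mul_left_comm]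
    _ ≤ stepSize S A * Fintype.card (S × A) * M.optValue := by
        rw [mul_assoc]
        exact mul_le_mul_of_nonneg_left M.sum_maxMarginal_mul_marginalGain_le
          (stepSize_nonneg S A)

theorem mean_regret_le (M : SubmodularMDP S A) {arg : ℕ → S → (A → ℝ) → A}
    (harg : IsArgmaxRule arg) (k : ℕ) :
    mean (M.iterates arg k) (M.regret k) ≤
      k * stepSize S A * (stepSize S A * Fintype.card (S × A) * M.optValue) := by
  induction k with
  | zero => simp [iterates, mean_pure, regret]
  | succ k ih =>
    have step (d : Fin k → S → A) :
        mean ((M.gradientEstimate (M.position d)).map fun w =>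
            Fin.snoc (α := fun _ => S → A) d (M.dpPolicy (arg k) w)) (M.regret (k + 1)) ≤
          M.regret k d +
            stepSize S A * (stepSize S A * Fintype.card (S × A) * M.optValue) := by
      rw [show (fun w => Fin.snoc (α := fun _ => S → A) d (M.dpPolicy (arg k) w)) =
        Fin.snoc d ∘ M.dpPolicy (arg k) from rfl, ← PMF.map_comp, mean_map]
      simp only [regret, Fin.init_snoc, Fin.snoc_last, mean_const_add, mean_const_mul]
      exact add_le_add_right (mul_le_mul_of_nonneg_left
        (M.mean_additiveLoss_dpPolicy_le (harg k) _) (stepSize_nonneg S A)) _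
    rw [iterates, mean_bind]
    refine (mean_mono step).trans ?_
    rw [mean_add, mean_const, Nat.cast_succ, add_mul, add_mul, one_mul]
    exact add_le_add_left ih _

theorem continuousGreedy_guarantee (M : SubmodularMDP S A) {arg : ℕ → S → (A → ℝ) → A}
    (harg : IsArgmaxRule arg) {p : ℝ} (hp : 0 < p) :
    ENNReal.ofReal (1 - p) ≤ (M.continuousGreedy arg).toOuterMeasure
      {ρ | ∀ π, (1 - 1 / Real.exp 1 - (1 + 1 / p) / 9 / Fintype.card (S × A)) * M.value π ≤
        M.H * M.randomValue ρ} := by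
  have : Nonempty S := ⟨M.s₁⟩
  set errorRate := stepSize S A * Fintype.card (S × A) with errorRate_def
  have errorRate_nonneg : 0 ≤ errorRate := mul_nonneg (stepSize_nonneg S A) (Nat.cast_nonneg _)
  have total_error : (1 + 1 / p) / 9 / Fintype.card (S × A) = errorRate + errorRate / p := by
    rw [errorRate_def, stepSize_mul_card]
    field_simp
  have mean_le : mean (M.iterates arg (numSteps S A)) (M.regret _) ≤
      p * (errorRate / p * M.optValue) := by
    refine (M.mean_regret_le harg _).trans_eq ?_
    rw [numSteps_mul_stepSize, one_mul, ← mul_assoc, mul_div_cancel₀ _ hp.ne']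
  rw [continuousGreedy, PMF.toOuterMeasure_map_apply, total_error]
  exact (ofReal_one_sub_le_toOuterMeasure_of_mean_le (M.regret_nonneg _) hp.le
    (mul_nonneg (div_nonneg errorRate_nonneg hp.le) M.optValue_nonneg) mean_le).trans
    (MeasureTheory.measure_mono fun d hd => M.mul_value_le_horizon_mul_randomValue hd)

end Sampling

end SubmodularMDP

theorem one_sub_one_div_exp_one_nonneg : 0 ≤ 1 - 1 / Real.exp 1 :=
  sub_nonneg.2 ((div_le_one (Real.exp_pos 1)).2 (Real.one_le_exp zero_le_one))

theorem mainTheorem1_general {p : ℝ} (hp : 0 < p) :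
    ∃ ε : ℕ → ℝ,
      Filter.Tendsto ε Filter.atTop (nhds 0) ∧
      (∀ n, 0 ≤ ε n ∧ ε n ≤ 1 - 1 / Real.exp 1) ∧
      ∀ (S : Type*) (A : Type*) [Fintype S] [Fintype A] [DecidableEq S] [DecidableEq A]
        [Nonempty A] (M : SubmodularMDP S A) (arg : ℕ → S → (A → ℝ) → A),
        IsArgmaxRule arg →
        ENNReal.ofReal (1 - p) ≤
          (M.continuousGreedy arg).toOuterMeasure
            {ρ | ∀ πstar : Policy S A,
              (1 - 1 / Real.exp 1 - ε (Fintype.card S * Fintype.card A)) / (M.H : ℝ)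
                * M.value πstar ≤ M.randomValue ρ} := by
  let ε (n : ℕ) : ℝ := min (1 - 1 / Real.exp 1) ((1 + 1 / p) / 9 / n)
  have ε_nonneg (n : ℕ) : 0 ≤ ε n := le_min one_sub_one_div_exp_one_nonneg (by positivity)
  refine ⟨ε, squeeze_zero ε_nonneg (fun n => min_le_right _ _)
    (tendsto_const_div_atTop_nhds_zero_nat _), fun n => ⟨ε_nonneg n, min_le_left _ _⟩, ?_⟩
  intro S A _ _ _ _ _ M arg harg
  refine (M.continuousGreedy_guarantee harg hp).trans
    (MeasureTheory.measure_mono fun ρ hρ π => ?_)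
  rw [div_mul_eq_mul_div, div_le_iff₀' (Nat.cast_pos.2 M.H_pos), ← Fintype.card_prod,
    show ε (Fintype.card (S × A)) = min _ _ from rfl, ← max_sub_sub_left, sub_self,
    max_mul_of_nonneg _ _ (M.value_nonneg π), zero_mul]
  exact max_le (mul_nonneg (Nat.cast_nonneg _) (M.randomValue_nonneg ρ)) (hρ π)

theorem mainTheorem1 :
    ∃ ε : ℕ → ℝ,
      Filter.Tendsto ε Filter.atTop (nhds 0) ∧
      (∀ n, 0 ≤ ε n ∧ ε n ≤ 1 - 1 / Real.exp 1) ∧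
      ∀ (S : Type*) (A : Type*) [Fintype S] [Fintype A] [DecidableEq S] [DecidableEq A]
        [Nonempty A] (M : SubmodularMDP S A) (arg : ℕ → S → (A → ℝ) → A),
        IsArgmaxRule arg →
        (99 / 100 : ENNReal) ≤
          (M.continuousGreedy arg).toOuterMeasure
            {ρ | ∀ πstar : Policy S A,
              (1 - 1 / Real.exp 1 - ε (Fintype.card S * Fintype.card A)) ^ 2 / (M.H : ℝ)
                * M.value πstar ≤ M.randomValue ρ} := by
  obtain ⟨ε, tendsto_zero, ε_mem, guarantee⟩ := mainTheorem1_general (p := 1 / 100) (by norm_num)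
  refine ⟨ε, tendsto_zero, ε_mem, fun S A _ _ _ _ _ M arg harg => ?_⟩
  have probability_eq : (99 / 100 : ENNReal) = ENNReal.ofReal (1 - 1 / 100) := by
    rw [show (1 - 1 / 100 : ℝ) = 99 / 100 by norm_num, ENNReal.ofReal_div_of_pos (by norm_num)]
    norm_num
  rw [probability_eq]
  refine (guarantee S A M arg harg).trans
    (MeasureTheory.measure_mono fun ρ hρ π => le_trans ?_ (hρ π))
  obtain ⟨ε_nonneg, ε_le⟩ := ε_mem (Fintype.card S * Fintype.card A)
  have factor_le_one : 1 - 1 / Real.exp 1 - ε (Fintype.card S * Fintype.card A) ≤ 1 := by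
    linarith [one_div_pos.2 (Real.exp_pos 1)]
  have := M.value_nonneg π
  gcongr
  exact pow_le_of_le_one (sub_nonneg.2 ε_le) factor_le_one two_ne_zero
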